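/- Let $K$ be a field of characteristic $0$ (for instance $\mathbb{C}$), let $r,m\ge 0$, and let $\alpha^j,\beta^j,\gamma^j$ ($j=1,\dots,m$), $\delta,\varepsilon\in K$ be arbitrary constants. Consider independent variables $u_n$, $y^j_n$ ($n\in\mathbb{Z}$, $1\le j\le m$) and $t_1,\dots,t_r$, and let $P$ be the ring of polynomials in them over $K$. Define polynomials $h^{(i)}_n$ in the variables $u_k$ by $h^{(0)}_n=\tfrac12$ and $$h^{(i+1)}_n=u_n\sum_{s=0}^{i}\bigl(h^{(s)}_{n+1}+h^{(s)}_n\bigr)\bigl(h^{(i-s)}_n+h^{(i-s)}_{n-1}\bigr)-\sum_{s=1}^{i}h^{(s)}_nh^{(i+1-s)}_n .$$ Consider the system of equations, for all $n\in\mathbb{Z}$, $$\left\{\begin{aligned}&u_n(y^j_{n+1}+y^j_n)(y^j_n+y^j_{n-1})=\alpha^j(y^j_n)^2+(-1)^n\beta^jy^j_n+\gamma^j,\qquad j=1,\dots,m,\\&2\sum_{i=1}^r i\,t_i\,h^{(i)}_n+n-\delta+(-1)^n\varepsilon=y^1_n+\dots+y^m_n,\end{aligned}\right.$$ and the $K$-linear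 derivations $D_1,\dots,D_r$ of $P$ (derivations with respect to $t_1,\dots,t_r$) given by $$D_i(u_n)=u_n\bigl(h^{(i)}_{n+1}-h^{(i)}_{n-1}\bigr),\qquad D_i(y^j_n)=h^{(i)}_{n,\xi^j},\qquad D_i(t_k)=\delta_{ik},$$ where $\delta_{ik}$ is the Kronecker symbol and $f\mapsto f_{,\xi^j}$ is the derivation on polynomials in the variables $u_k$ with $u_{k,\xi^j}=u_k(y^j_{k+1}-y^j_{k-1})$. Say that $p\in P$ vanishes in virtue of the system if $p$ belongs to the ideal generated by all the equations (left-hand side minus right-hand side, for all $n$ and $j$) after all the sums $y^j_n+y^j_{n-1}$ have been inverted, that is, if $s\,p$ lies in the ideal of $P$ generated by the equations for some finite product $s$ of such sums. Then the system is consistent with the derivations $D_1,\dots,D_r$: if $p\in P$ vanishes in virtue of the system, then so does $D_i(p)$, for every $i$; in particular this holds when $p$ is any of the equations. Moreover $D_iD_k=D_kD_i$ on $P$ for all $i,k$. For $r=2$, with $x=t_1$ and $t=t_2$, the last equation of the system is $$4tu_n(u_{n+1}+u_n+u_{n-1})+2xu_n+n-\delta+(-1)^n\varepsilon=y^1_n+\dots+y^m_n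 .$$ -/

import Mathlib

noncomputable section

namespace Volterra

open MvPolynomial

/-- The independent variables: the lattice field `u_n`, the auxiliary fields `y^j_n`
(`n ∈ ℤ`, `j = 1, …, m`) and the parameters `t_1, …, t_r`.  Indices in `Fin` start at `0`,
so `Var.t i` stands for `t_{i+1}`. -/
inductive Var (r m : ℕ) : Type
  | u (n : ℤ) : Var r m
  | y (j : Fin m) (n : ℤ) : Var r m
  | t (i : Fin r) : Var r m

/-- Polynomials in all the variables `u_n`, `y^j_n`, `t_i`. -/
abbrev Poly (K : Type*) [Field K] (r m : ℕ) : Type _ := MvPolynomial (Var r m) K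

section

variable (K : Type*) [Field K] {r m : ℕ}

/-- `u_n` -/
def u (n : ℤ) : Poly K r m := X (Var.u n)

/-- `y^j_n` -/
def y (j : Fin m) (n : ℤ) : Poly K r m := X (Var.y j n)

/-- `t_{i+1}` -/
def t (i : Fin r) : Poly K r m := X (Var.t i)

/-- The homogeneous polynomials `h^(i)_n` in the variables `u_k`:  `h^(0)_n = 1/2` and
`h^(i+1)_n = u_n ∑_{s=0}^{i} (h^(s)_{n+1} + h^(s)_n) (h^(i-s)_n + h^(i-s)_{n-1})
  - ∑_{s=1}^{i} h^(s)_n h^(i+1-s)_n`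
(the last sum is written with `s + 1`, `0 ≤ s < i`, in place of `s`). -/
def h : ℕ → ℤ → Poly K r m
  | 0, _ => C (1 / 2)
  | i + 1, n =>
      u K n * ∑ s : Fin (i + 1),
          (h s (n + 1) + h s n) * (h (i - s) n + h (i - s) (n - 1))
        - ∑ s : Fin i, h (s + 1) n * h (i - s) n
  termination_by i => i
  decreasing_by all_goals omega

/-- The derivation `∂/∂ξ^j`, `u_{n,ξ^j} = u_n (y^j_{n+1} - y^j_{n-1})`.  It is only ever applied to
polynomials in the variables `u_n`, on which it is determined by this rule; the value `0` on the
other variables is a convention that plays no role. -/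
def Dξ (j : Fin m) : Derivation K (Poly K r m) (Poly K r m) :=
  mkDerivation K fun v => match v with
    | Var.u n => u K n * (y K j (n + 1) - y K j (n - 1))
    | Var.y _ _ => 0
    | Var.t _ => 0

/-- The derivation with respect to the parameter `t_{i+1}`:
`u_{n,t_i} = u_n (h^(i)_{n+1} - h^(i)_{n-1})`, `y^j_{n,t_i} = h^(i)_{n,ξ^j}`,
`t_{k,t_i} = δ_{ik}`. -/
def Dt (i : Fin r) : Derivation K (Poly K r m) (Poly K r m) :=
  mkDerivation K fun v => match v with
    | Var.u n => u K n * (h K (i + 1) (n + 1) - h K (i + 1) (n - 1))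
    | Var.y j n => Dξ K j (h K (i + 1) n)
    | Var.t k => if k = i then 1 else 0

/-- The denominators: products of the polynomials `y^j_n + y^j_{n-1}`. -/
def denominators (r m : ℕ) : Submonoid (Poly K r m) :=
  Submonoid.closure {p | ∃ (j : Fin m) (n : ℤ), p = y K j n + y K j (n - 1)}

end

section

variable {K : Type*} [Field K] {r m : ℕ}

/-- Left-hand side minus right-hand side of
`u_n (y^j_{n+1} + y^j_n) (y^j_n + y^j_{n-1}) = α^j (y^j_n)^2 + (-1)^n β^j y^j_n + γ^j`. -/
def quadEq (r : ℕ) (α β γ : Fin m → K) (j : Fin m) (n : ℤ) : Poly K r m :=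
  u K n * (y K j (n + 1) + y K j n) * (y K j n + y K j (n - 1))
    - (C (α j) * y K j n ^ 2 + C ((-1) ^ n * β j) * y K j n + C (γ j))

/-- Left-hand side minus right-hand side of
`2 ∑_{i=1}^{r} i t_i h^(i)_n + n - δ + (-1)^n ε = y^1_n + ⋯ + y^m_n`. -/
def linEq (r m : ℕ) (δ ε : K) (n : ℤ) : Poly K r m :=
  2 * ∑ i : Fin r, ((i : ℕ) + 1 : Poly K r m) * t K i * h K (i + 1) n
    + C ((n : K) - δ + (-1) ^ n * ε) - ∑ j : Fin m, y K j n

/-- The ideal generated by all the equations of the system, for all `n ∈ ℤ`. -/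
def systemIdeal (r : ℕ) (α β γ : Fin m → K) (δ ε : K) : Ideal (Poly K r m) :=
  Ideal.span ({p | ∃ (j : Fin m) (n : ℤ), p = quadEq r α β γ j n} ∪
    {p | ∃ n : ℤ, p = linEq r m δ ε n})

/-- `p = 0` in virtue of the system, on the set where no `y^j_n + y^j_{n-1}` vanishes: `p` belongs
to the ideal generated by the equations after the inversion of all `y^j_n + y^j_{n-1}`, that is,
some product of these sums multiplies `p` into the ideal of the system. -/
def VanishesOnSystem (α β γ : Fin m → K) (δ ε : K) (p : Poly K r m) : Prop :=
  ∃ s ∈ denominators K r m, s * p ∈ systemIdeal r α β γ δ ε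

end

end Volterra

end

noncomputable section

namespace Volterra

/-! ### Linearizing a quadratic recurrence for power series. -/

section PowerSeriesLemmas

open PowerSeries

/-! Write λ for the formal variable and put H_n = ∑ h^(i)_n λ^i. The recursion for h^(i) says H_n² -
1/4 = λ u_n (H_{n+1} + H_n)(H_n + H_{n-1}). A derivation of the ring applied to this identity gives
a linear equation with a unique solution, since each term is divisible by λ up to the unit 2H_n.
Uniqueness yields `linearized_step`, which compares the derivatives of H along two directions y, z
linked by the recursion that links h^(i) to h^(i+1).

For y = h^(i), z = h^(i+1) this gives the symmetry `flow_h_symm`, hence commutativity. For z = α^j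
y^j it determines the ξ^j-derivative of H explicitly, so that the derivatives of the quadratic
equations vanish. For the last equation, a single derivation E sends each u_n, hence each h^(i)_n,
into the ideal, and E(h^(i)_n) is the D_i-derivative of the equation. -/

/-- If every term of a sequence of power series is `X` times a combination of the terms of
the sequence, then the sequence vanishes. -/
theorem eq_zero_of_eq_X_mul {A : Type*} [CommRing A] {V : ℤ → A⟦X⟧} {a b c : ℤ → A⟦X⟧}
    (hV : ∀ n, V n = X * (a n * V (n + 1) + b n * V n + c n * V (n - 1))) (n : ℤ) : V n = 0 := by
  have key : ∀ (k : ℕ) (n : ℤ), (X : A⟦X⟧) ^ k ∣ V n := by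
    intro k
    induction k with
    | zero => intro n; simp
    | succ k ih =>
      intro n
      rw [hV n, pow_succ']
      exact mul_dvd_mul_left X (dvd_add (dvd_add ((ih _).mul_left _) ((ih _).mul_left _))
        ((ih _).mul_left _))
  ext k
  rw [map_zero]
  exact X_pow_dvd_iff.1 (key (k + 1) n) k (Nat.lt_succ_self k)

variable {A : Type*} [CommRing A] {u : ℤ → A} {H : ℤ → A⟦X⟧} {e : A⟦X⟧}

/-- The quadratic recurrence for the generating function implies a linear one. -/
theorem linear_recurrence
    (hu : ∀ n, IsUnit (H (n + 1) + H n))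
    (hq : ∀ n, H n ^ 2 - e = X * C (u n) * (H (n + 1) + H n) * (H n + H (n - 1))) (n : ℤ) :
    H (n + 1) - H n =
      X * (C (u (n + 1)) * (H (n + 2) + H (n + 1)) - C (u n) * (H n + H (n - 1))) := by
  have h1 := hq (n + 1)
  rw [show n + 1 + 1 = n + 2 by ring, show n + 1 - 1 = n by ring] at h1
  apply (hu n).mul_left_cancel
  linear_combination h1 - hq n

/-- The linearization of the quadratic recurrence, `W` being the derivative of `H` and
`u n * (y (n + 1) - y (n - 1))` that of `u n`. -/
def IsLinearized (u : ℤ → A) (H : ℤ → A⟦X⟧) (y : ℤ → A) (W : ℤ → A⟦X⟧) : Prop :=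
  ∀ n, 2 * H n * W n = X * C (u n) *
    (C (y (n + 1) - y (n - 1)) * (H (n + 1) + H n) * (H n + H (n - 1))
      + (W (n + 1) + W n) * (H n + H (n - 1)) + (H (n + 1) + H n) * (W n + W (n - 1)))

/-- `Z` is a particular solution making `X * W' n - W n - Z n` satisfy the homogeneous linearized
recurrence, so this combination is zero. An alternating `b` is harmless: its contributions at `n`
and `n - 1` cancel. -/
theorem linearized_step
    (hu : ∀ n, IsUnit (H (n + 1) + H n)) (hH : ∀ n, IsUnit (2 * H n))
    (hq : ∀ n, H n ^ 2 - e = X * C (u n) * (H (n + 1) + H n) * (H n + H (n - 1)))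
    {y z b : ℤ → A} {W W' : ℤ → A⟦X⟧}
    (hb : ∀ n, b (n + 1) = - b n)
    (hyz : ∀ n, u (n + 1) * (y (n + 2) + y (n + 1)) - u n * (y n + y (n - 1)) =
      z (n + 1) - z n + b n)
    (hW : IsLinearized u H y W) (hW' : IsLinearized u H z W') (n : ℤ) :
    W n = X * (W' n - C (u n) * ((H (n + 1) + H n) * C (y n + y (n - 1))
      - (H n + H (n - 1)) * C (y (n + 1) + y n))) := by
  set Z : ℤ → A⟦X⟧ := fun n => X * C (u n) * ((H (n + 1) + H n) * C (y n + y (n - 1))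
      - (H n + H (n - 1)) * C (y (n + 1) + y n)) with hZ
  have hZsum : ∀ n, Z (n + 1) + Z n = C (y (n + 1) + y n) * (H (n + 1) - H n)
      - X * (H (n + 1) + H n) * C (z (n + 1) - z n + b n) := by
    intro n
    have h1 := linear_recurrence hu hq n
    rw [h1, ← hyz n]
    simp only [hZ, show n + 1 + 1 = n + 2 by ring, show n + 1 - 1 = n by ring, map_sub, map_mul,
      map_add]
    ring
  have hV : ∀ n, X * W' n - W n - Z n = 0 := by
    choose v hv using fun n => (hH n).exists_left_inv
    refine eq_zero_of_eq_X_mul (V := fun n => X * W' n - W n - Z n)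
      (a := fun n => v n * C (u n) * (H n + H (n - 1)))
      (b := fun n => v n * C (u n) * (H (n + 1) + H n + (H n + H (n - 1))))
      (c := fun n => v n * C (u n) * (H (n + 1) + H n)) ?_
    intro n
    have key : 2 * H n * (X * W' n - W n - Z n) = X * C (u n) *
        (((X * W' (n + 1) - W (n + 1) - Z (n + 1)) + (X * W' n - W n - Z n)) * (H n + H (n - 1))
          + (H (n + 1) + H n) *
            ((X * W' n - W n - Z n) + (X * W' (n - 1) - W (n - 1) - Z (n - 1)))) := by
      have h1 := hZsum n
      have h2 := hZsum (n - 1)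
      have h3 := hb (n - 1)
      rw [show n - 1 + 1 = n by ring] at h2 h3
      have h4 : Z n = X * C (u n) * ((H (n + 1) + H n) * C (y n + y (n - 1))
        - (H n + H (n - 1)) * C (y (n + 1) + y n)) := rfl
      rw [h3] at h1
      simp only [map_sub, map_add, map_neg] at h1 h2 h4 ⊢
      have h5 := hW n
      have h6 := hW' n
      simp only [map_sub] at h5 h6
      linear_combination X * h6 - h5 - 2 * H n * h4 + X * C (u n) * (H n + H (n - 1)) * h1
        + X * C (u n) * (H (n + 1) + H n) * h2
    linear_combination v n * key - (X * W' n - W n - Z n) * hv n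
  have := hV n
  simp only [hZ] at this
  linear_combination -this

/-- The linearization of the equation for `y`, in generating form. -/
theorem linearized_quadratic_eq_zero
    (hu : ∀ n, IsUnit (H (n + 1) + H n)) (hH : ∀ n, IsUnit (2 * H n))
    (hq : ∀ n, H n ^ 2 - e = X * C (u n) * (H (n + 1) + H n) * (H n + H (n - 1)))
    {y b : ℤ → A} {a : A} {W : ℤ → A⟦X⟧}
    (hb : ∀ n, b (n + 1) = - b n)
    (hy : ∀ n, u (n + 1) * (y (n + 2) + y (n + 1)) - u n * (y n + y (n - 1)) =
      a * (y (n + 1) - y n) - b n)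
    (hW : IsLinearized u H y W) (n : ℤ) :
    C (u n) * ((H (n + 1) - H (n - 1)) * C (y (n + 1) + y n) * C (y n + y (n - 1))
      + (W (n + 1) + W n) * C (y n + y (n - 1)) + C (y (n + 1) + y n) * (W n + W (n - 1)))
      - C (2 * a * y n + b n) * W n = 0 := by
  -- The linearization is linear in the pair (y, W). With z = a y the step relation therefore closes
  -- on `W` itself and can be solved by dividing by 1 - aλ.
  have hW' : IsLinearized u H (fun n => a * y n) (fun n => C a * W n) := by
    intro n
    have := hW n
    simp only [map_sub, map_mul] at this ⊢
    linear_combination C a * this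
  have step := linearized_step hu hH hq (y := y) (z := fun n => a * y n) (b := fun n => - b n)
    (fun n => by rw [hb n]) (fun n => by rw [hy n]; ring) hW hW'
  have hsum : ∀ n, (1 - X * C a) * (W (n + 1) + W n) =
      - (C (y (n + 1) + y n) * (H (n + 1) - H n))
      + X * (H (n + 1) + H n) * C (a * (y (n + 1) - y n) - b n) := by
    intro n
    have h0 := step n
    have h1 := step (n + 1)
    have h2 := linear_recurrence hu hq n
    rw [← hy n]
    simp only [show n + 1 + 1 = n + 2 by ring, show n + 1 - 1 = n by ring, map_sub, map_mul,
      map_add] at *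
    linear_combination h0 + h1 + (C (y (n + 1)) + C (y n)) * h2
  have hunit : IsUnit (1 - X * C a : A⟦X⟧) := by
    rw [isUnit_iff_constantCoeff]; simp
  apply hunit.mul_left_cancel
  have h0 := step n
  have h1 := hsum n
  have h2 := hsum (n - 1)
  have h3 := hb (n - 1)
  rw [show n - 1 + 1 = n by ring] at h2 h3
  simp only [h3, map_sub, map_mul, map_add, map_neg, map_ofNat] at *
  linear_combination C (u n) * (C (y n) + C (y (n - 1))) * h1
    + C (u n) * (C (y (n + 1)) + C (y n)) * h2 - (2 * C a * C (y n) - C (b (n - 1))) * h0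

/-- A derivation acting on the coefficients of a power series. -/
def coeffDeriv {K P : Type*} [CommRing K] [CommRing P] [Algebra K P] (D : Derivation K P P) :
    P⟦X⟧ →+ P⟦X⟧ where
  toFun f := PowerSeries.mk fun i => D (coeff i f)
  map_zero' := by ext; simp
  map_add' f g := by ext; simp

section CoeffDeriv

variable {K P : Type*} [CommRing K] [CommRing P] [Algebra K P] (D : Derivation K P P)

@[simp] theorem coeff_coeffDeriv (f : P⟦X⟧) (i : ℕ) :
    coeff i (coeffDeriv D f) = D (coeff i f) := by simp [coeffDeriv]

theorem coeffDeriv_mul (f g : P⟦X⟧) :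
    coeffDeriv D (f * g) = coeffDeriv D f * g + f * coeffDeriv D g := by
  ext i
  simp only [coeff_coeffDeriv, coeff_mul, map_add, map_sum, Derivation.leibniz, smul_eq_mul,
    ← Finset.sum_add_distrib]
  exact Finset.sum_congr rfl fun _ _ => by ring

@[simp] theorem coeffDeriv_C (a : P) : coeffDeriv D (C a) = C (D a) := by
  ext i
  rw [coeff_coeffDeriv, coeff_C, coeff_C]
  split_ifs <;> simp

@[simp] theorem coeffDeriv_X : coeffDeriv D (X : P⟦X⟧) = 0 := by
  ext i
  rw [coeff_coeffDeriv, coeff_X]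
  split_ifs <;> simp

end CoeffDeriv

end PowerSeriesLemmas

/-! ### The polynomials h^(i) and the commuting flows. -/

section VolterraHierarchy

open MvPolynomial

variable (K : Type*) [Field K] {r m : ℕ}

theorem h_zero (n : ℤ) : (h K 0 n : Poly K r m) = C (1 / 2) := by rw [h]

theorem h_succ (i : ℕ) (n : ℤ) : (h K (i + 1) n : Poly K r m) =
    u K n * ∑ s ∈ Finset.range (i + 1),
        (h K s (n + 1) + h K s n) * (h K (i - s) n + h K (i - s) (n - 1))
      - ∑ s ∈ Finset.range i, h K (s + 1) n * h K (i - s) n := by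
  rw [h, Finset.sum_range, Finset.sum_range]

theorem h_one [CharZero K] (n : ℤ) : (h K 1 n : Poly K r m) = u K n := by
  have h2 : (C (1 / 2) + C (1 / 2) : Poly K r m) = 1 := by
    rw [← C_add, add_halves, C_1]
  rw [show 1 = 0 + 1 from rfl, h_succ]
  simp [h_zero, ← two_mul] at h2 ⊢
  simp [h2]

theorem h_two [CharZero K] (n : ℤ) : (h K 2 n : Poly K r m) =
    u K n * (u K (n + 1) + u K n + u K (n - 1)) := by
  have h2 : (C (1 / 2) + C (1 / 2) : Poly K r m) = 1 := by
    rw [← C_add, add_halves, C_1]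
  rw [show 2 = 1 + 1 from rfl, h_succ]
  simp only [Finset.sum_range_succ, Finset.sum_range_zero, h_zero, h_one, h2, Nat.sub_zero,
    Nat.sub_self, zero_add]
  ring

/-- The generating function `∑ h^(i)_n λ^i`. -/
def hSeries (n : ℤ) : PowerSeries (Poly K r m) := PowerSeries.mk fun i => h K i n

@[simp] theorem coeff_hSeries (i : ℕ) (n : ℤ) :
    PowerSeries.coeff i (hSeries K n : PowerSeries (Poly K r m)) = h K i n := by
  simp [hSeries]

theorem constantCoeff_hSeries (n : ℤ) :
    PowerSeries.constantCoeff (hSeries K n : PowerSeries (Poly K r m)) = C (1 / 2) := by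
  rw [← PowerSeries.coeff_zero_eq_constantCoeff_apply, coeff_hSeries, h_zero]

/-- The two extreme terms of the square together give h^(i+1)_n because h^(0)_n = 1/2; the remaining
ones form the second sum of the recursion. -/
theorem hSeries_quadratic [CharZero K] (n : ℤ) :
    (hSeries K n ^ 2 - PowerSeries.C (C (1 / 4)) : PowerSeries (Poly K r m)) =
      PowerSeries.X * PowerSeries.C (u K n) * (hSeries K (n + 1) + hSeries K n)
        * (hSeries K n + hSeries K (n - 1)) := by
  have h2 : (C (1 / 2) + C (1 / 2) : Poly K r m) = 1 := by
    rw [← C_add, add_halves, C_1]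
  ext1 i
  rw [mul_assoc, mul_assoc]
  cases i with
  | zero =>
    rw [PowerSeries.coeff_zero_X_mul, PowerSeries.coeff_zero_eq_constantCoeff_apply, map_sub,
      map_pow, constantCoeff_hSeries, PowerSeries.constantCoeff_C, ← C_pow, ← C_sub]
    norm_num
  | succ i =>
    rw [PowerSeries.coeff_succ_X_mul, PowerSeries.coeff_C_mul, map_sub, PowerSeries.coeff_C,
      if_neg (Nat.succ_ne_zero i), sub_zero, sq, PowerSeries.coeff_mul, PowerSeries.coeff_mul,
      Finset.Nat.sum_antidiagonal_eq_sum_range_succ_mk,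
      Finset.Nat.sum_antidiagonal_eq_sum_range_succ_mk, Finset.sum_range_succ,
      Finset.sum_range_succ']
    simp only [coeff_hSeries, map_add, Nat.sub_self, Nat.sub_zero, h_zero,
      Nat.add_sub_add_right]
    have := h_succ K i n (r := r) (m := m)
    linear_combination this + h K (i + 1) n * h2

theorem isUnit_hSeries_add [CharZero K] (n k : ℤ) :
    IsUnit (hSeries K n + hSeries K k : PowerSeries (Poly K r m)) := by
  rw [PowerSeries.isUnit_iff_constantCoeff, map_add, constantCoeff_hSeries, constantCoeff_hSeries,
    ← C_add, add_halves, C_1]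
  exact isUnit_one

theorem h_linear [CharZero K] (i : ℕ) (n : ℤ) :
    (u K (n + 1) * (h K i (n + 2) + h K i (n + 1)) - u K n * (h K i n + h K i (n - 1)) :
      Poly K r m) = h K (i + 1) (n + 1) - h K (i + 1) n := by
  have := congrArg (PowerSeries.coeff (i + 1)) (linear_recurrence (A := Poly K r m)
    (fun n => isUnit_hSeries_add K (n + 1) n) (hSeries_quadratic K) n)
  simpa [PowerSeries.coeff_succ_X_mul] using this.symm

theorem h_mem_adjoin (i : ℕ) (n : ℤ) :
    (h K i n : Poly K r m) ∈ Algebra.adjoin K (Set.range (u K : ℤ → Poly K r m)) := by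
  induction i using Nat.strong_induction_on generalizing n with
  | _ i ih =>
    cases i with
    | zero => rw [h_zero]; exact Subalgebra.algebraMap_mem _ _
    | succ i =>
      rw [h_succ]
      refine sub_mem (mul_mem (Algebra.subset_adjoin ⟨n, rfl⟩) (sum_mem fun s hs => ?_))
        (sum_mem fun s hs => ?_)
      · have := Finset.mem_range.1 hs
        exact mul_mem (add_mem (ih _ (by omega) _) (ih _ (by omega) _))
          (add_mem (ih _ (by omega) _) (ih _ (by omega) _))
      · have := Finset.mem_range.1 hs
        exact mul_mem (ih _ (by omega) _) (ih _ (by omega) _)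

variable {K}

/-- Derivations which agree on the `u_n` agree on the `h^(i)_n`. -/
theorem derivation_h_congr {M : Type*} [AddCommGroup M] [Module K M] [Module (Poly K r m) M]
    {D₁ D₂ : Derivation K (Poly K r m) M} (hD : ∀ n, D₁ (u K n) = D₂ (u K n)) (i : ℕ) (n : ℤ) :
    D₁ (h K i n) = D₂ (h K i n) := by
  refine Derivation.eqOn_adjoin ?_ (h_mem_adjoin K i n)
  rintro _ ⟨k, rfl⟩
  exact hD k

variable (K) in
/-- The derivation with `u_n ↦ u_n (f_{n+1} - f_{n-1})`, zero on the other variables. -/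
def flow (f : ℤ → Poly K r m) : Derivation K (Poly K r m) (Poly K r m) :=
  mkDerivation K fun v => match v with
    | Var.u n => u K n * (f (n + 1) - f (n - 1))
    | Var.y _ _ => 0
    | Var.t _ => 0

@[simp] theorem flow_u (f : ℤ → Poly K r m) (n : ℤ) :
    flow K f (u K n) = u K n * (f (n + 1) - f (n - 1)) := mkDerivation_X _ _ _

@[simp] theorem Dξ_u (j : Fin m) (n : ℤ) :
    Dξ K j (u K n : Poly K r m) = u K n * (y K j (n + 1) - y K j (n - 1)) := mkDerivation_X _ _ _

@[simp] theorem Dt_u (i : Fin r) (n : ℤ) : Dt K i (u K n : Poly K r m) =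
    u K n * (h K (i + 1) (n + 1) - h K (i + 1) (n - 1)) := mkDerivation_X _ _ _

@[simp] theorem Dt_y (i : Fin r) (j : Fin m) (n : ℤ) : Dt K i (y K j n : Poly K r m) =
    Dξ K j (h K (i + 1) n) := mkDerivation_X _ _ _

@[simp] theorem Dt_t (i k : Fin r) : Dt K i (t K k : Poly K r m) = if k = i then 1 else 0 :=
  mkDerivation_X _ _ _

open PowerSeries in
/-- The generating functions of the `h^(i)` satisfy, over any quotient of the ring of
polynomials, the linearized recurrence along a derivation. -/
theorem isLinearized_hSeries [CharZero K] {A : Type*} [CommRing A] (π : Poly K r m →+* A)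
    {f : ℤ → Poly K r m} {D : Derivation K (Poly K r m) (Poly K r m)}
    (hD : ∀ n, D (u K n) = u K n * (f (n + 1) - f (n - 1))) :
    IsLinearized (fun n => π (u K n)) (fun n => PowerSeries.map π (hSeries K n))
      (fun n => π (f n)) (fun n => PowerSeries.map π (coeffDeriv D (hSeries K n))) := by
  intro n
  -- Differentiation precedes projection: `D` need not descend to the quotient.
  have h1 := congrArg (PowerSeries.map π) (congrArg (coeffDeriv D)
    (hSeries_quadratic K n (r := r) (m := m)))
  simp only [sq, coeffDeriv_mul, map_sub, map_add, map_mul, coeffDeriv_C, coeffDeriv_X, hD,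
    PowerSeries.map_X, PowerSeries.map_C, map_zero, derivation_C] at h1 ⊢
  linear_combination h1

theorem map_hSeries_quadratic [CharZero K] {A : Type*} [CommRing A] (π : Poly K r m →+* A)
    (n : ℤ) :
    (PowerSeries.map π (hSeries K n) ^ 2 - PowerSeries.map π (PowerSeries.C (C (1 / 4)))) =
      PowerSeries.X * PowerSeries.C (π (u K n))
        * (PowerSeries.map π (hSeries K (n + 1)) + PowerSeries.map π (hSeries K n))
        * (PowerSeries.map π (hSeries K n) + PowerSeries.map π (hSeries K (n - 1))) := by
  have := congrArg (PowerSeries.map π) (hSeries_quadratic K n (r := r) (m := m))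
  simpa only [map_sub, map_mul, map_add, map_pow, PowerSeries.map_X, PowerSeries.map_C] using this

theorem isUnit_map_hSeries_add [CharZero K] {A : Type*} [CommRing A] (π : Poly K r m →+* A)
    (n k : ℤ) :
    IsUnit (PowerSeries.map π (hSeries K n) + PowerSeries.map π (hSeries K k)) := by
  rw [← map_add]
  exact (isUnit_hSeries_add K n k).map _

/-- The symmetry `h^(k)_{n,t_i} = h^(i)_{n,t_k}`. -/
theorem flow_h_symm [CharZero K] (i k : ℕ) (n : ℤ) :
    flow K (h K i) (h K k n : Poly K r m) = flow K (h K k) (h K i n) := by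
  have step : ∀ i k, flow K (h K i) (h K (k + 1) n : Poly K r m) = flow K (h K (i + 1)) (h K k n)
      - u K n * ((h K k (n + 1) + h K k n) * (h K i n + h K i (n - 1))
        - (h K k n + h K k (n - 1)) * (h K i (n + 1) + h K i n)) := by
    intro i k
    have := linearized_step (u := u K) (H := hSeries K) (y := h K i) (z := h K (i + 1))
      (b := 0) (fun n => isUnit_hSeries_add K (n + 1) n)
      (fun n => by rw [two_mul]; exact isUnit_hSeries_add K n n)
      (hSeries_quadratic K (r := r) (m := m)) (fun n => by simp)
      (fun n => by simpa using h_linear K i n)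
      (by simpa using isLinearized_hSeries (RingHom.id _) (flow_u (h K i)))
      (by simpa using isLinearized_hSeries (RingHom.id _) (flow_u (h K (i + 1)))) n
    have := congrArg (PowerSeries.coeff (k + 1)) this
    simp only [PowerSeries.coeff_succ_X_mul, map_sub, PowerSeries.coeff_C_mul,
      PowerSeries.coeff_mul_C, coeff_coeffDeriv, coeff_hSeries] at this
    simpa only [map_add, coeff_hSeries] using this
  induction k generalizing i with
  | zero =>
    have : flow K (h K 0) (h K i n : Poly K r m) = (0 : Derivation K _ _) (h K i n) :=
      derivation_h_congr (fun n => by simp [h_zero]) i n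
    rw [this, h_zero, derivation_C]
    rfl
  | succ k ih =>
    -- The correction term in `step` is antisymmetric in i and k, so applying it in both orders
    -- cancels it.
    rw [step, ih, step]
    ring

theorem Dt_h (i : Fin r) (k : ℕ) (n : ℤ) :
    Dt K i (h K k n : Poly K r m) = flow K (h K (i + 1)) (h K k n) :=
  derivation_h_congr (fun n => by simp) k n

theorem Dt_h_symm [CharZero K] (i k : Fin r) (n : ℤ) :
    Dt K i (h K (k + 1) n : Poly K r m) = Dt K k (h K (i + 1) n) := by
  rw [Dt_h, Dt_h, flow_h_symm]

/-- The rule D_i(y^j_n) = h^(i)_{n,ξ^j} is exactly what makes the commutator vanish on every u_n. -/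
theorem Dt_Dξ_h (i : Fin r) (j : Fin m) (k : ℕ) (n : ℤ) :
    Dt K i (Dξ K j (h K k n : Poly K r m)) = Dξ K j (Dt K i (h K k n)) := by
  have := derivation_h_congr (D₁ := ⁅Dt (m := m) K i, Dξ (r := r) K j⁆)
    (D₂ := 0) (fun n => by
      simp only [Derivation.commutator_apply, Dt_u, Dξ_u, Derivation.leibniz, map_sub, smul_eq_mul,
        Dt_y, Derivation.zero_apply]
      ring) k n
  rwa [Derivation.commutator_apply, Derivation.zero_apply, sub_eq_zero] at this

theorem Dt_comm [CharZero K] (i k : Fin r) (p : Poly K r m) :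
    Dt K i (Dt K k p) = Dt K k (Dt K i p) := by
  have : ⁅Dt (m := m) K i, Dt (m := m) K k⁆ = 0 := by
    apply derivation_ext
    rintro (n | ⟨j, n⟩ | l)
    · change ⁅Dt (m := m) K i, Dt (m := m) K k⁆ (u K n) = 0
      simp only [Derivation.commutator_apply, Dt_u, Derivation.leibniz, map_sub, smul_eq_mul]
      rw [Dt_h_symm i k, Dt_h_symm i k]
      ring
    · change ⁅Dt (m := m) K i, Dt (m := m) K k⁆ (y K j n) = 0
      rw [Derivation.commutator_apply, Dt_y, Dt_y, Dt_Dξ_h, Dt_Dξ_h, Dt_h_symm, sub_self]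
    · change ⁅Dt (m := m) K i, Dt (m := m) K k⁆ (t K l) = 0
      rw [Derivation.commutator_apply, Dt_t, Dt_t]
      split_ifs <;> simp
  have := DFunLike.congr_fun this p
  rwa [Derivation.commutator_apply, Derivation.zero_apply, sub_eq_zero] at this

end VolterraHierarchy

/-! ### Consistency modulo the saturated ideal. -/

section Consistency

open MvPolynomial

variable {K : Type*} [Field K] {r m : ℕ}

/-- A derivation mapping all `u_n` into an ideal maps all `h^(i)_n` into it. -/
theorem derivation_h_mem {J : Ideal (Poly K r m)} {D : Derivation K (Poly K r m) (Poly K r m)}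
    (hD : ∀ n, D (u K n) ∈ J) (i : ℕ) (n : ℤ) : D (h K i n) ∈ J := by
  -- Reduction mod `J` turns `D` into a module-valued derivation killing all u_n.
  have := derivation_h_congr (D₁ := J.mkQ.compDer D) (D₂ := 0)
    (fun n => (Submodule.Quotient.mk_eq_zero J).2 (hD n)) i n
  exact (Submodule.Quotient.mk_eq_zero J).1 this

theorem derivation_sum_apply {ι : Type*} (s : Finset ι)
    (D : ι → Derivation K (Poly K r m) (Poly K r m)) (p : Poly K r m) :
    (∑ k ∈ s, D k) p = ∑ k ∈ s, D k p := by
  rw [← Finset.sum_apply]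
  exact congrFun (map_sum Derivation.coeFnAddMonoidHom D s) p

variable (K r m) in
/-- The Euler derivation. -/
def euler : Derivation K (Poly K r m) (Poly K r m) := mkDerivation K X

@[simp] theorem euler_u (n : ℤ) : euler K r m (u K n) = u K n := mkDerivation_X _ _ _

theorem euler_h (i : ℕ) (n : ℤ) : euler K r m (h K i n) = (i : Poly K r m) * h K i n := by
  induction i using Nat.strong_induction_on generalizing n with
  | _ i ih =>
    cases i with
    | zero => rw [h_zero, derivation_C]; simp
    | succ i =>
      rw [h_succ, map_sub, Derivation.leibniz, euler_u, map_sum, map_sum]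
      have h1 : ∀ s ∈ Finset.range (i + 1),
          euler K r m ((h K s (n + 1) + h K s n) * (h K (i - s) n + h K (i - s) (n - 1))) =
            (i : Poly K r m) *
              ((h K s (n + 1) + h K s n) * (h K (i - s) n + h K (i - s) (n - 1))) := by
        intro s hs
        have hs := Finset.mem_range.1 hs
        simp only [Derivation.leibniz, map_add, smul_eq_mul]
        rw [ih s (by omega), ih s (by omega), ih (i - s) (by omega), ih (i - s) (by omega),
          Nat.cast_sub (by omega)]
        ring
      have h2 : ∀ s ∈ Finset.range i, euler K r m (h K (s + 1) n * h K (i - s) n) =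
            ((i + 1 : ℕ) : Poly K r m) * (h K (s + 1) n * h K (i - s) n) := by
        intro s hs
        have hs := Finset.mem_range.1 hs
        rw [Derivation.leibniz, smul_eq_mul, smul_eq_mul, ih (s + 1) (by omega),
          ih (i - s) (by omega), Nat.cast_sub (by omega)]
        push_cast
        ring
      rw [Finset.sum_congr rfl h1, Finset.sum_congr rfl h2, ← Finset.mul_sum, ← Finset.mul_sum]
      simp only [smul_eq_mul]
      push_cast
      ring

variable {α β γ : Fin m → K} {δ ε : K}

variable (r α β γ δ ε) in
/-- The ideal of the polynomials which vanish in virtue of the system. -/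
def saturatedIdeal : Ideal (Poly K r m) where
  carrier := {p | VanishesOnSystem α β γ δ ε p}
  zero_mem' := ⟨1, one_mem _, by simp⟩
  add_mem' := by
    rintro p q ⟨s, hs, hp⟩ ⟨s', hs', hq⟩
    refine ⟨s * s', mul_mem hs hs', ?_⟩
    rw [show s * s' * (p + q) = s' * (s * p) + s * (s' * q) by ring]
    exact add_mem (Ideal.mul_mem_left _ _ hp) (Ideal.mul_mem_left _ _ hq)
  smul_mem' := by
    rintro a p ⟨s, hs, hp⟩
    refine ⟨s, hs, ?_⟩
    rw [smul_eq_mul, mul_left_comm]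
    exact Ideal.mul_mem_left _ _ hp

theorem systemIdeal_le : systemIdeal r α β γ δ ε ≤ saturatedIdeal r α β γ δ ε :=
  fun p hp => ⟨1, one_mem _, by rwa [one_mul]⟩

theorem mem_saturatedIdeal_of_mul_mem {s p : Poly K r m} (hs : s ∈ denominators K r m)
    (hp : s * p ∈ saturatedIdeal r α β γ δ ε) : p ∈ saturatedIdeal r α β γ δ ε := by
  obtain ⟨s', hs', hp⟩ := hp
  exact ⟨s' * s, mul_mem hs' hs, by rwa [mul_assoc]⟩

theorem quadEq_mem (j : Fin m) (n : ℤ) :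
    quadEq r α β γ j n ∈ saturatedIdeal r α β γ δ ε :=
  systemIdeal_le (Ideal.subset_span (Or.inl ⟨j, n, rfl⟩))

theorem linEq_mem (n : ℤ) : linEq r m δ ε n ∈ saturatedIdeal r α β γ δ ε :=
  systemIdeal_le (Ideal.subset_span (Or.inr ⟨n, rfl⟩))

theorem neg_one_zpow_add_one (n : ℤ) : (-1 : K) ^ (n + 1) = - (-1) ^ n := by
  rw [zpow_add_one₀ (by simp)]; ring

/-- The linear consequence of the equations for `y^j_n`. -/
theorem y_linear_mem (j : Fin m) (n : ℤ) :
    u K (n + 1) * (y K j (n + 2) + y K j (n + 1)) - u K n * (y K j n + y K j (n - 1))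
      - (C (α j) * (y K j (n + 1) - y K j n) - C ((-1) ^ n * β j))
        ∈ saturatedIdeal r α β γ δ ε := by
  -- The difference of consecutive equations has this common factor; cancelling it is why
  -- denominators are needed.
  refine mem_saturatedIdeal_of_mul_mem (s := y K j (n + 1) + y K j n)
    (Submonoid.subset_closure ⟨j, n + 1, by rw [add_sub_cancel_right]⟩) ?_
  have := sub_mem (quadEq_mem (r := r) (α := α) (β := β) (γ := γ) (δ := δ) (ε := ε) j (n + 1))
    (quadEq_mem (r := r) (α := α) (β := β) (γ := γ) (δ := δ) (ε := ε) j n)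
  convert this using 1
  simp only [quadEq, neg_one_zpow_add_one, show n + 1 + 1 = n + 2 by ring,
    show n + 1 - 1 = n by ring, neg_mul, map_neg]
  ring

theorem Dt_quadEq_mem [CharZero K] (i : Fin r) (j : Fin m) (n : ℤ) :
    Dt K i (quadEq r α β γ j n) ∈ saturatedIdeal r α β γ δ ε := by
  set π := Ideal.Quotient.mk (saturatedIdeal r α β γ δ ε) with hπ
  have key := linearized_quadratic_eq_zero (u := fun n => π (u K n))
    (H := fun n => PowerSeries.map π (hSeries K n)) (y := fun n => π (y K j n))
    (b := fun n => π (C ((-1) ^ n * β j))) (a := π (C (α j)))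
    (W := fun n => PowerSeries.map π (coeffDeriv (Dξ K j) (hSeries K n)))
    (fun n => isUnit_map_hSeries_add π (n + 1) n)
    (fun n => by rw [two_mul]; exact isUnit_map_hSeries_add π n n)
    (map_hSeries_quadratic π)
    (fun n => by rw [neg_one_zpow_add_one, neg_mul, map_neg, map_neg])
    (fun n => by
      have := Ideal.Quotient.eq.2
        (y_linear_mem (r := r) (α := α) (β := β) (γ := γ) (δ := δ) (ε := ε) j n)
      simpa only [map_sub, map_mul, map_add] using this)
    (isLinearized_hSeries π (Dξ_u j)) n
  -- The index `i` stands for t_{i+1}; this coefficient is the Leibniz expansion of the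
  -- differentiated equation.
  have := congrArg (PowerSeries.coeff ((i : ℕ) + 1)) key
  rw [map_sub, PowerSeries.coeff_C_mul, PowerSeries.coeff_C_mul, map_add, map_add, mul_assoc,
    ← map_mul PowerSeries.C] at this
  simp only [PowerSeries.coeff_mul_C, PowerSeries.coeff_C_mul] at this
  simp only [map_sub, map_add, PowerSeries.coeff_map, coeff_coeffDeriv, coeff_hSeries,
    map_zero] at this
  rw [← Ideal.Quotient.eq_zero_iff_mem, ← hπ, ← this]
  simp only [quadEq, map_sub, map_add, Derivation.leibniz, Derivation.leibniz_pow, smul_eq_mul,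
    Dt_u, Dt_y, derivation_C, map_mul, map_pow, map_zero, nsmul_eq_mul, map_ofNat,
    Nat.cast_ofNat]
  ring

theorem Dt_linEq_mem [CharZero K] (i : Fin r) (n : ℤ) :
    Dt K i (linEq r m δ ε n) ∈ saturatedIdeal r α β γ δ ε := by
  -- `E` is chosen so that E(u_n) is u_n times the difference of the last equations at n + 1 and n -
  -- 1. The Euler term accounts for (n + 1) - (n - 1) = 2; the δ and ε terms cancel.
  set E : Derivation K (Poly K r m) (Poly K r m) :=
    (2 : Poly K r m) • ∑ k : Fin r, (((k : ℕ) + 1 : Poly K r m) * t K k) • Dt K k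
      - ∑ j : Fin m, Dξ K j + (2 : Poly K r m) • euler K r m with hE
  have hEp : ∀ p, E p = 2 * ∑ k : Fin r, (((k : ℕ) + 1 : Poly K r m) * t K k) * Dt K k p
      - ∑ j : Fin m, Dξ K j p + 2 * euler K r m p := by
    intro p
    rw [hE, Derivation.add_apply, Derivation.sub_apply, Derivation.smul_apply,
      Derivation.smul_apply, derivation_sum_apply, derivation_sum_apply]
    rfl
  have hEu : ∀ n, E (u K n) ∈ saturatedIdeal r α β γ δ ε := by
    intro n
    have := Ideal.mul_mem_left _ (u K n)
      (sub_mem (linEq_mem (α := α) (β := β) (γ := γ) (δ := δ) (ε := ε) (r := r) (n + 1))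
        (linEq_mem (α := α) (β := β) (γ := γ) (δ := δ) (ε := ε) (r := r) (n - 1)))
    convert this using 1
    have hsign : ((-1 : K)) ^ (n - 1) = (-1) ^ (n + 1) := by
      rw [zpow_add_one₀ (by simp), zpow_sub_one₀ (by simp)]; norm_num
    have hc : (C (((n + 1 : ℤ) : K) - δ + (-1) ^ (n + 1) * ε) : Poly K r m)
        - C (((n - 1 : ℤ) : K) - δ + (-1) ^ (n - 1) * ε) = 2 := by
      rw [← C_sub, hsign, ← map_ofNat C 2]
      push_cast
      congr 1
      ring
    rw [hEp, euler_u]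
    have h1 : ∑ k : Fin r, (((k : ℕ) + 1 : Poly K r m) * t K k) * Dt K k (u K n) =
        u K n * (∑ k : Fin r, ((k : ℕ) + 1 : Poly K r m) * t K k * h K (k + 1) (n + 1)
          - ∑ k : Fin r, ((k : ℕ) + 1 : Poly K r m) * t K k * h K (k + 1) (n - 1)) := by
      rw [← Finset.sum_sub_distrib, Finset.mul_sum]
      exact Finset.sum_congr rfl fun k _ => by rw [Dt_u]; ring
    have h2 : ∑ j : Fin m, Dξ K j (u K n : Poly K r m) =
        u K n * (∑ j : Fin m, y K j (n + 1) - ∑ j : Fin m, y K j (n - 1)) := by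
      rw [← Finset.sum_sub_distrib, Finset.mul_sum]
      exact Finset.sum_congr rfl fun j _ => Dξ_u j n
    rw [h1, h2, linEq, linEq]
    linear_combination -(u K n) * hc
  -- By the symmetry of the flows, E(h^(i+1)_n) is the derivative of the equation; the Euler term,
  -- by homogeneity, matches the explicit dependence on t_{i+1}.
  have := derivation_h_mem hEu (i + 1) n
  convert this using 1
  rw [hEp, euler_h]
  simp only [linEq, map_sub, map_add, map_sum, Derivation.leibniz, smul_eq_mul, Dt_y, Dt_t,
    derivation_C, Derivation.map_natCast, Derivation.map_one_eq_zero, mul_zero, add_zero]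
  have h2 : Dt K i (2 : Poly K r m) = 0 := by
    exact_mod_cast Derivation.map_natCast (Dt (m := m) K i) 2
  have h3 : ∀ k : Fin r, Dt K i (h K (k + 1) n : Poly K r m) = Dt K k (h K (i + 1) n) :=
    fun k => Dt_h_symm i k n
  simp only [h2, h3, mul_zero, add_zero, mul_ite, mul_one, Finset.sum_add_distrib,
    Finset.sum_ite_eq', Finset.mem_univ, if_true]
  push_cast
  ring

theorem Dt_mem_saturatedIdeal [CharZero K] (i : Fin r) {p : Poly K r m}
    (hp : p ∈ saturatedIdeal r α β γ δ ε) : Dt K i p ∈ saturatedIdeal r α β γ δ ε := by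
  have hsys : ∀ q ∈ systemIdeal r α β γ δ ε, Dt K i q ∈ saturatedIdeal r α β γ δ ε := by
    intro q hq
    refine Submodule.span_induction ?_ ?_ ?_ ?_ hq
    · rintro _ (⟨j, n, rfl⟩ | ⟨n, rfl⟩)
      · exact Dt_quadEq_mem i j n
      · exact Dt_linEq_mem i n
    · rw [map_zero]; exact zero_mem _
    · intro a b _ _ ha hb
      rw [map_add]; exact add_mem ha hb
    · intro a b hb hDb
      rw [smul_eq_mul, Derivation.leibniz]
      exact add_mem (Ideal.mul_mem_left _ _ hDb)
        (Ideal.mul_mem_right _ _ (systemIdeal_le hb))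
  obtain ⟨s, hs, hsp⟩ := id hp
  -- s D(p) = D(s p) - p D(s), and both terms on the right lie in the saturated ideal.
  refine mem_saturatedIdeal_of_mul_mem hs ?_
  have := hsys _ hsp
  rw [Derivation.leibniz, smul_eq_mul, smul_eq_mul] at this
  exact (Ideal.add_mem_iff_left _ (Ideal.mul_mem_right _ _ hp)).1 this

end Consistency

end Volterra

end

theorem proposition4 (K : Type*) [Field K] [CharZero K] :
    -- arbitrary numbers of parameters `t_i` and of auxiliary variables `y^j`
    (∀ (r m : ℕ),
      -- consistency of the system with the derivations in `t_1, …, t_r`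
      (∀ (α β γ : Fin m → K) (δ ε : K) (i : Fin r) (p : Volterra.Poly K r m),
        Volterra.VanishesOnSystem α β γ δ ε p →
          Volterra.VanishesOnSystem α β γ δ ε (Volterra.Dt K i p)) ∧
      -- mutual commutativity of these derivations
      (∀ (i k : Fin r) (p : Volterra.Poly K r m),
        Volterra.Dt K i (Volterra.Dt K k p) = Volterra.Dt K k (Volterra.Dt K i p))) ∧
    -- the last equation of the system in the case `r = 2`
    (∀ (m : ℕ) (δ ε : K) (n : ℤ),
      Volterra.linEq 2 m δ ε n =
        4 * Volterra.t K 1 * Volterra.u K n *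
            (Volterra.u K (n + 1) + Volterra.u K n + Volterra.u K (n - 1))
          + 2 * Volterra.t K 0 * Volterra.u K n
          + MvPolynomial.C ((n : K) - δ + (-1) ^ n * ε)
          - ∑ j : Fin m, Volterra.y K j n) := by
  refine ⟨fun r m => ⟨fun α β γ δ ε i p hp => Volterra.Dt_mem_saturatedIdeal i hp,
    Volterra.Dt_comm⟩, fun m δ ε n => ?_⟩
  rw [Volterra.linEq, Fin.sum_univ_two]
  simp only [Fin.val_zero, Fin.val_one, Nat.cast_zero, Nat.cast_one, zero_add, one_add_one_eq_two,
    Volterra.h_one, Volterra.h_two]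
  ring
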